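/- Let $\mathbb{S}^2\subset\mathbb{R}^3$ be the unit sphere with its geodesic distance $\operatorname{dist}(p,q)=\arccos\langle p,q\rangle$, tangent spaces $T_p\mathbb{S}^2=p^\perp$ and Riemannian logarithm $\log_p:\mathbb{S}^2\setminus\{-p\}\to T_p\mathbb{S}^2$ (so $\log_p(q)$ is the tangent vector of length $\operatorname{dist}(p,q)$ at $p$ pointing towards $q$), and let $\mathrm{pr}(x)=x/\|x\|$ for $x\in\mathbb{R}^3\setminus\{0\}$. For an $\mathbb{S}^2$-valued random variable $Y$, an intrinsic (Fréchet) mean is a minimizer $m\in\mathbb{S}^2$ of $q\mapsto\mathbb{E}[\operatorname{dist}(q,Y)^2]$; when it is unique, the intrinsic covariance of $Y$ is the linear map $\operatorname{Cov}(Y)=\mathbb{E}\big[\log_m(Y)\log_m(Y)^T\big]:T_m\mathbb{S}^2\to T_m\mathbb{S}^2$. Let $\mu\in\mathbb{R}^3\setminus\{0\}$, $\sigma\ge 0$ and $X\sim N(\mu,\sigma^2I_3)$ (with $X=\mu$ almost surely if $\sigma=0$). Then $\mathrm{pr}(X)$ has a unique intrinsic mean and its intrinsic covariance is isotropic: \[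 \operatorname{Cov}(\mathrm{pr}(X))=v\,I_2\qquad\text{with}\qquad 0\le v<\frac{\pi^2-4}{4}. \] Moreover $v=\tfrac12\operatorname{tr}\operatorname{Cov}(\mathrm{pr}(X))$ depends on $(\mu,\sigma)$ only through $\lambda=\sigma^2/\|\mu\|^2$, and the resulting map \[ f:[0,\infty)\to\Big[0,\tfrac{\pi^2-4}{4}\Big),\qquad f\Big(\frac{\sigma^2}{\|\mu\|^2}\Big)=\tfrac12\operatorname{tr}\operatorname{Cov}(\mathrm{pr}(X)), \] is a strictly increasing bijection. -/

import Mathlib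

open MeasureTheory ProbabilityTheory Set

noncomputable section

namespace ProjectedNormal

/-- Euclidean three-space. -/
abbrev E3 : Type := EuclideanSpace ℝ (Fin 3)

/-- The unit sphere `S²` in `ℝ³`. -/
abbrev S2 : Type := Metric.sphere (0 : E3) 1

/-- The projection `x ↦ x / ‖x‖` onto `S²`. It is undefined at the origin, where the value
is an arbitrary point. -/
def pr (x : E3) : S2 :=
  if h : x = 0 then ⟨EuclideanSpace.single 0 1, by simp⟩
  else ⟨‖x‖⁻¹ • x, by simp [norm_smul, h]⟩

/-- The geodesic (great-circle) distance on `S²`. -/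
def sphDist (p q : S2) : ℝ := Real.arccos (inner ℝ (p : E3) (q : E3))

/-- The tangent space `T_p S²`: the vectors orthogonal to `p`, with the inner product
inherited from `ℝ³`. -/
abbrev Tangent (p : S2) : Submodule ℝ E3 := (Submodule.span ℝ {(p : E3)})ᗮ

/-- The Riemannian logarithm `log_p(q)`: the tangent vector at `p` of length `sphDist p q` that
points in the direction of `q`, i.e. along the component of `q` orthogonal to `p`. It is `0` at
`q = p`; at the cut point `q = -p`, where the logarithm is undefined, the value is `0` too. -/
def sphLog (p q : S2) : Tangent p :=
  (sphDist p q / ‖(Tangent p).orthogonalProjectionOnto (q : E3)‖) •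
    (Tangent p).orthogonalProjectionOnto (q : E3)

/-- `m` is an intrinsic (Fréchet) mean of the law `ν` on `S²`: it minimizes the expected squared
geodesic distance. -/
def IsIntrinsicMean (ν : Measure S2) (m : S2) : Prop :=
  ∀ q : S2, ∫ y, sphDist m y ^ 2 ∂ν ≤ ∫ y, sphDist q y ^ 2 ∂ν

/-- The covariance operator `∫ log_m(y) log_m(y)ᵀ dν(y)` on `T_m S²`. It is the intrinsic
covariance of `ν` when `m` is the intrinsic mean of `ν`. -/
def intrinsicCov (ν : Measure S2) (m : S2) : Tangent m →L[ℝ] Tangent m :=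
  ∫ y, InnerProductSpace.rankOne ℝ (sphLog m y) (sphLog m y) ∂ν

end ProjectedNormal

end

/-! Write `X = μ + σZ` with `Z` standard Gaussian. Dividing by `‖μ‖` does not change `pr`, so only
`e = pr μ` and `s = σ/‖μ‖` matter, and `s² = λ` (`map_pr_of_hasLaw`).

The mean is `e`: for `q ≠ e`, reflection in the bisecting plane of `e` and `q` swaps the two
distances, while for `s > 0` the density of `e + sZ` is larger on the side of `e`
(`integral_sq_angle_lt`); `s = 0` is a point mass. The law is invariant under isometries fixing `e`,
so the covariance is a scalar, namely half its trace `E[dist(e, pr(e + sZ))²]`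
(`intrinsicCov_projectedLaw`).

For almost every `z` the angle from `e` to `e + sz` increases strictly and continuously with `s`,
from `0` towards the angle from `e` to `z`. By dominated convergence the expected squared angle
(`spread`) increases continuously from `0` to its unattained limit `E[angle(e, Z)²]`. The direction
of `Z` is uniform, so this limit is `½ ∫ θ² sin θ dθ = (π² - 4)/2`, and half of it is the stated
bound. -/

namespace ProjectedNormal

open InnerProductGeometry Real
open scoped ENNReal

/-! ### Gaussian density -/

section Density

variable {V : Type*} [NormedAddCommGroup V] [InnerProductSpace ℝ V] [FiniteDimensional ℝ V]
  [MeasurableSpace V] [BorelSpace V]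

/-- The standard Gaussian measure has a density proportional to `exp (-‖x‖² / 2)`. -/
theorem exists_stdGaussian_eq_withDensity :
    ∃ c : ℝ, 0 < c ∧ stdGaussian V =
      volume.withDensity fun x : V => ENNReal.ofReal (c * rexp (-(1 / 2) * ‖x‖ ^ 2)) := by
  set I : ℝ := ∫ x : V, rexp (-(1 / 2) * ‖x‖ ^ 2) with hI
  have hIval : I = (π / (1 / 2)) ^ (Module.finrank ℝ V / 2 : ℝ) :=
    GaussianFourier.integral_rexp_neg_mul_sq_norm (V := V) (b := 1 / 2) (by norm_num)
  have hIpos : 0 < I := by rw [hIval]; positivity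
  have hinteg : Integrable fun x : V => rexp (-(1 / 2) * ‖x‖ ^ 2) :=
    Integrable.of_integral_ne_zero hIpos.ne'
  have hcomplex : (I : ℂ) = (π / (1 / 2 : ℂ)) ^ (Module.finrank ℝ V / 2 : ℂ) := by
    have h := GaussianFourier.integral_cexp_neg_mul_sq_norm (V := V) (b := 1 / 2) (by norm_num)
    rw [← h, hI, ← integral_complex_ofReal]
    simp
  refine ⟨I⁻¹, inv_pos.2 hIpos, ?_⟩
  have : IsFiniteMeasure
      (volume.withDensity fun x : V => ENNReal.ofReal (I⁻¹ * rexp (-(1 / 2) * ‖x‖ ^ 2))) :=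
    isFiniteMeasure_withDensity_ofReal (hinteg.const_mul _).2
  -- Finite measures with equal characteristic functions agree; that of the density is a Gaussian
  -- Fourier integral whose prefactor is `I`.
  refine Measure.ext_of_charFun ?_
  ext t
  rw [charFun_stdGaussian, charFun_apply,
    integral_withDensity_eq_integral_toReal_smul (by fun_prop) (by simp)]
  have h := GaussianFourier.integral_cexp_neg_mul_sq_norm_add (V := V) (b := 1 / 2)
    (by norm_num) Complex.I t
  rw [← hcomplex] at h
  have hI0 : (I : ℂ) ≠ 0 := by exact_mod_cast hIpos.ne'
  calc Complex.exp (-‖t‖ ^ 2 / 2)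
      = (I : ℂ)⁻¹ * ∫ v : V, Complex.exp (-(1 / 2 : ℂ) * ‖v‖ ^ 2 + Complex.I * inner ℝ t v) := by
        rw [h, inv_mul_cancel_left₀ hI0]
        congr 1
        simp
        ring
    _ = _ := by
        rw [← integral_const_mul]
        refine integral_congr_ae (ae_of_all _ fun v => ?_)
        have hp : 0 ≤ I⁻¹ * rexp (-(1 / 2) * ‖v‖ ^ 2) := by positivity
        simp only [ENNReal.toReal_ofReal hp, Complex.real_smul, Complex.exp_add, real_inner_comm t v]
        push_cast
        rw [mul_comm Complex.I]
        ring

theorem stdGaussian_absolutelyContinuous : stdGaussian V ≪ volume := by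
  obtain ⟨c, -, h⟩ := exists_stdGaussian_eq_withDensity (V := V)
  rw [h]
  exact withDensity_absolutelyContinuous _ _

theorem ae_stdGaussian_notMem_submodule (S : Submodule ℝ V) (hS : S ≠ ⊤) :
    ∀ᵐ z ∂stdGaussian V, z ∉ S :=
  stdGaussian_absolutelyContinuous.ae_le (measure_eq_zero_iff_ae_notMem.1
    (Measure.addHaar_submodule volume S hS))

end Density

/-! ### Monotonicity of the angle along a ray -/

section Angle

variable {V : Type*} [NormedAddCommGroup V] [InnerProductSpace ℝ V]

theorem measurable_angle [MeasurableSpace V] [BorelSpace V] [SecondCountableTopology V] (e : V) :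
    Measurable fun x : V => angle e x := by
  unfold angle
  fun_prop

/-- This is the cosine of the angle to `e` of a vector with component `t` along `e` and squared
distance `b` from the line `ℝe`. When `t` and `u` have the same sign, squaring reduces the claim to
comparing `b t²` with `b u²`. -/
theorem strictMono_div_sqrt_sq_add {b : ℝ} (hb : 0 < b) :
    StrictMono fun t : ℝ => t / √(t ^ 2 + b) := by
  intro t u htu
  have ht : 0 < √(t ^ 2 + b) := Real.sqrt_pos.2 (by positivity)
  have hu : 0 < √(u ^ 2 + b) := Real.sqrt_pos.2 (by positivity)
  have ht2 : √(t ^ 2 + b) ^ 2 = t ^ 2 + b := Real.sq_sqrt (by positivity)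
  have hu2 : √(u ^ 2 + b) ^ 2 = u ^ 2 + b := Real.sq_sqrt (by positivity)
  change t / √(t ^ 2 + b) < u / √(u ^ 2 + b)
  rw [div_lt_div_iff₀ ht hu]
  rcases le_or_gt 0 t with h0 | h0
  · refine lt_of_pow_lt_pow_left₀ 2 (by nlinarith) ?_
    rw [mul_pow, mul_pow, ht2, hu2]
    nlinarith [mul_pos hb (mul_pos (sub_pos.2 htu) (by linarith : 0 < u + t))]
  · rcases le_or_gt 0 u with h1 | h1
    · nlinarith [mul_nonneg h1 ht.le, mul_pos (neg_pos.2 h0) hu]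
    · suffices -u * √(t ^ 2 + b) < -t * √(u ^ 2 + b) by linarith
      refine lt_of_pow_lt_pow_left₀ 2 (by nlinarith) ?_
      rw [mul_pow, mul_pow, ht2, hu2]
      nlinarith [mul_pos hb (mul_pos (sub_pos.2 htu) (by linarith : 0 < -u - t))]

theorem ne_zero_of_notMem_span {e z : V} (hz : z ∉ Submodule.span ℝ {e}) (r : ℝ) :
    z + r • e ≠ 0 := by
  intro h
  refine hz ?_
  rw [eq_neg_of_add_eq_zero_left h]
  exact Submodule.neg_mem _ (Submodule.smul_mem _ _ (Submodule.mem_span_singleton_self e))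

/-- Adding more of the unit vector `e` to `z` brings it closer to `e` in direction. -/
theorem angle_add_smul_strictAnti {e z : V} (he : ‖e‖ = 1) (hz : z ∉ Submodule.span ℝ {e}) :
    StrictAnti fun r : ℝ => angle e (z + r • e) := by
  have hee : inner ℝ e e = (1 : ℝ) := by simp [he]
  set a := inner ℝ e z with ha
  -- This is the squared norm of the component of `z` orthogonal to `e`.
  have hb : 0 < ‖z‖ ^ 2 - a ^ 2 := by
    have h0 : 0 < ‖z + (-a) • e‖ ^ 2 :=
      pow_pos (norm_pos_iff.2 (ne_zero_of_notMem_span hz (-a))) 2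
    rw [norm_add_sq_real, inner_smul_right, norm_smul, he, real_inner_comm, ← ha] at h0
    simp only [norm_neg, Real.norm_eq_abs, mul_one, sq_abs] at h0
    linarith
  have key : ∀ r : ℝ, angle e (z + r • e) =
      arccos ((a + r) / √((a + r) ^ 2 + (‖z‖ ^ 2 - a ^ 2))) := by
    intro r
    have hn : ‖z + r • e‖ = √((a + r) ^ 2 + (‖z‖ ^ 2 - a ^ 2)) := by
      have h2 : ‖z + r • e‖ ^ 2 = (a + r) ^ 2 + (‖z‖ ^ 2 - a ^ 2) := by
        rw [norm_add_sq_real, inner_smul_right, norm_smul, he, real_inner_comm, ← ha]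
        simp only [Real.norm_eq_abs, mul_one, sq_abs]
        ring
      rw [← h2, Real.sqrt_sq (norm_nonneg _)]
    rw [angle, hn, inner_add_right, inner_smul_right, hee, he]
    simp [ha]
  intro r r' hrr
  simp only [key]
  refine Real.strictAntiOn_arccos ?_ ?_ (strictMono_div_sqrt_sq_add hb (by linarith)) <;>
  · rw [mem_Icc, ← abs_le, abs_div, abs_of_nonneg (Real.sqrt_nonneg _)]
    refine div_le_one_of_le₀ (Real.abs_le_sqrt (by linarith)) (Real.sqrt_nonneg _)

/-- Angles ignore positive scaling. The substitution `r = s⁻¹` turns decrease in `r` into increase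
in `s`, and `s → ∞` into `r → 0`. -/
theorem angle_add_smul_eq {e z : V} {s : ℝ} (hs : 0 < s) :
    angle e (e + s • z) = angle e (z + s⁻¹ • e) := by
  rw [← angle_smul_right_of_pos e (z + s⁻¹ • e) hs, smul_add, smul_inv_smul₀ hs.ne', add_comm]

/-- Along a ray that starts at the unit vector `e`, the angle to `e` is strictly increasing. -/
theorem angle_self_add_smul_strictMonoOn {e z : V} (he : ‖e‖ = 1)
    (hz : z ∉ Submodule.span ℝ {e}) : StrictMonoOn (fun s : ℝ => angle e (e + s • z)) (Ici 0) := by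
  have he0 : e ≠ 0 := by rintro rfl; simp at he
  intro s hs s' hs' h
  have hs'0 : 0 < s' := lt_of_le_of_lt hs h
  rcases (mem_Ici.1 hs).eq_or_lt with rfl | hs0
  · simp only [zero_smul, add_zero, angle_self he0]
    refine lt_of_le_of_ne (angle_nonneg _ _) fun h0 => ?_
    obtain ⟨-, r, -, hr⟩ := angle_eq_zero_iff.1 h0.symm
    refine hz (Submodule.mem_span_singleton.2 ⟨s'⁻¹ * (r - 1), ?_⟩)
    rw [mul_smul, sub_smul, ← hr, one_smul, add_sub_cancel_left, inv_smul_smul₀ hs'0.ne']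
  · simp only [angle_add_smul_eq hs0, angle_add_smul_eq hs'0]
    exact angle_add_smul_strictAnti he hz (inv_strictAnti₀ hs0 h)

theorem angle_self_add_smul_lt {e z : V} (he : ‖e‖ = 1) (hz : z ∉ Submodule.span ℝ {e}) {s : ℝ}
    (hs : 0 ≤ s) : angle e (e + s • z) < angle e z := by
  -- The detour through `s + 1 > 0` covers `s = 0`; its inverse is then compared with `r = 0`, which
  -- gives `z` itself.
  have h1 : angle e (e + s • z) < angle e (e + (s + 1) • z) :=
    angle_self_add_smul_strictMonoOn he hz hs (by simp; linarith) (by linarith)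
  refine h1.trans ?_
  rw [angle_add_smul_eq (by linarith)]
  have := angle_add_smul_strictAnti he hz (a := 0) (b := (s + 1)⁻¹) (by positivity)
  simpa using this

theorem tendsto_angle_self_add_smul {e z : V} (he : e ≠ 0) (hz : z ≠ 0) :
    Filter.Tendsto (fun s : ℝ => angle e (e + s • z)) Filter.atTop (nhds (angle e z)) := by
  have h : Filter.Tendsto (fun s : ℝ => (e, z + s⁻¹ • e)) Filter.atTop (nhds (e, z)) := by
    refine tendsto_const_nhds.prodMk_nhds ?_
    simpa using (tendsto_const_nhds (x := z)).add
      ((tendsto_inv_atTop_zero (𝕜 := ℝ)).smul_const e)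
  have h2 := (continuousAt_angle (x := (e, z)) he hz).tendsto.comp h
  refine h2.congr' ?_
  filter_upwards [Filter.eventually_gt_atTop 0] with s hs
  exact (angle_add_smul_eq hs).symm

theorem self_add_smul_ne_zero {e z : V} (he : e ≠ 0) (hz : z ∉ Submodule.span ℝ {e}) (s : ℝ) :
    e + s • z ≠ 0 := by
  intro h
  rcases eq_or_ne s 0 with rfl | hs
  · simp [he] at h
  · refine ne_zero_of_notMem_span hz s⁻¹ ?_
    rw [← smul_right_injective V hs |>.eq_iff]
    simp only [smul_add, smul_inv_smul₀ hs, smul_zero]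
    rw [add_comm, h]

theorem continuous_angle_self_add_smul {e z : V} (he : e ≠ 0) (hz : z ∉ Submodule.span ℝ {e}) :
    Continuous fun s : ℝ => angle e (e + s • z) := by
  refine continuous_iff_continuousAt.2 fun s => ?_
  exact ContinuousAt.comp (x := s) (g := fun y : V × V => angle y.1 y.2)
    (f := fun s : ℝ => (e, e + s • z)) (continuousAt_angle he (self_add_smul_ne_zero he hz s))
    (by fun_prop)

end Angle

/-! ### Spherical coordinates by two polar substitutions -/

section PolarIntegration

theorem lintegral_prod_comp_sq_add_sq {h : ℝ → ℝ≥0∞} (hh : Measurable h) :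
    ∫⁻ p : ℝ × ℝ, h (p.1 ^ 2 + p.2 ^ 2) =
      ENNReal.ofReal (2 * π) * ∫⁻ r in Ioi (0 : ℝ), ENNReal.ofReal r * h (r ^ 2) := by
  rw [← lintegral_comp_polarCoord_symm, polarCoord_target, Measure.volume_eq_prod,
    ← Measure.prod_restrict, lintegral_prod]
  · have : ∀ r θ : ℝ, (r * cos θ) ^ 2 + (r * sin θ) ^ 2 = r ^ 2 := fun r θ => by
      linear_combination r ^ 2 * Real.sin_sq_add_cos_sq θ
    simp only [polarCoord_symm_apply, this, smul_eq_mul, lintegral_const, Measure.restrict_apply,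
      MeasurableSet.univ, univ_inter, Real.volume_Ioo]
    rw [lintegral_mul_const _ (by fun_prop), mul_comm]
    congr 2
    ring
  · simp only [polarCoord_symm_apply, smul_eq_mul]
    exact Measurable.aemeasurable (by fun_prop)

theorem lintegral_euclideanSpace_three {h : ℝ → ℝ → ℝ≥0∞}
    (hh : Measurable fun p : ℝ × ℝ => h p.1 p.2) :
    ∫⁻ z : E3, h (z 0) (z 1 ^ 2 + z 2 ^ 2) =
      ∫⁻ x : ℝ, ∫⁻ p : ℝ × ℝ, h x (p.1 ^ 2 + p.2 ^ 2) := by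
  have e1 := EuclideanSpace.volume_preserving_symm_measurableEquiv_toLp (Fin 3)
  have e2 := volume_preserving_piFinSuccAbove (fun _ : Fin 3 => ℝ) 0
  have e3 := (MeasurePreserving.id (volume : Measure ℝ)).prod (volume_preserving_finTwoArrow ℝ)
  have hm : Measurable fun q : ℝ × ℝ × ℝ => h q.1 (q.2.1 ^ 2 + q.2.2 ^ 2) :=
    hh.comp (g := fun p : ℝ × ℝ => h p.1 p.2)
      (f := fun q : ℝ × ℝ × ℝ => (q.1, q.2.1 ^ 2 + q.2.2 ^ 2)) (by fun_prop)
  have := ((e3.comp e2).comp e1).lintegral_comp hm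
  rw [lintegral_prod _ hm.aemeasurable] at this
  exact this

/-- Integration over `ℝ³` of a function of the distance to the origin and of the angle to the
first coordinate axis. -/
theorem lintegral_norm_mul_angle {F G : ℝ → ℝ≥0∞} (hF : Measurable F) (hG : Measurable G) :
    ∫⁻ z : E3, F (‖z‖ ^ 2) * G (angle (EuclideanSpace.single 0 1 : E3) z) =
      (ENNReal.ofReal (2 * π) * ∫⁻ r in Ioi (0 : ℝ), ENNReal.ofReal (r ^ 2) * F (r ^ 2)) *
        ∫⁻ θ in Ioo 0 π, ENNReal.ofReal (sin θ) * G θ := by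
  let h : ℝ → ℝ → ℝ≥0∞ := fun x q => F (x ^ 2 + q) * G (arccos (x / √(x ^ 2 + q)))
  have hh : Measurable fun p : ℝ × ℝ => h p.1 p.2 := by
    simp only [h]
    fun_prop
  have h1 : ∀ z : E3, F (‖z‖ ^ 2) * G (angle (EuclideanSpace.single 0 1 : E3) z) =
      h (z 0) (z 1 ^ 2 + z 2 ^ 2) := by
    intro z
    have hn : ‖z‖ ^ 2 = z 0 ^ 2 + (z 1 ^ 2 + z 2 ^ 2) := by
      rw [EuclideanSpace.real_norm_sq_eq, Fin.sum_univ_three, add_assoc]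
    simp only [h, angle, ← hn, Real.sqrt_sq (norm_nonneg z)]
    simp [EuclideanSpace.inner_single_left]
  simp only [h1]
  rw [lintegral_euclideanSpace_three hh]
  have h2 : ∀ x : ℝ, Measurable (h x) := fun x => hh.comp measurable_prodMk_left
  simp only [fun x => lintegral_prod_comp_sq_add_sq (h2 x)]
  have hm : Measurable fun p : ℝ × ℝ => ENNReal.ofReal p.2 * h p.1 (p.2 ^ 2) := by
    simp only [h]
    fun_prop
  -- Extending by zero to `r ≤ 0` lets `(x, r)` range over the whole plane, so that polar
  -- coordinates apply again; the half-plane `r > 0` becomes `0 < θ < π`.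
  have hm' : Measurable fun p : ℝ × ℝ =>
      indicator (Ioi (0 : ℝ)) (fun r => ENNReal.ofReal r * h p.1 (r ^ 2)) p.2 := by
    have : (fun p : ℝ × ℝ =>
        indicator (Ioi (0 : ℝ)) (fun r => ENNReal.ofReal r * h p.1 (r ^ 2)) p.2) =
        indicator {p : ℝ × ℝ | 0 < p.2} fun p => ENNReal.ofReal p.2 * h p.1 (p.2 ^ 2) := by
      ext p
      simp [indicator]
    rw [this]
    exact hm.indicator (measurableSet_lt measurable_const measurable_snd)
  have h3 : ∀ x : ℝ, ∫⁻ r in Ioi (0 : ℝ), ENNReal.ofReal r * h x (r ^ 2) =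
      ∫⁻ r, indicator (Ioi (0 : ℝ)) (fun r => ENNReal.ofReal r * h x (r ^ 2)) r :=
    fun x => (lintegral_indicator measurableSet_Ioi _).symm
  simp only [h3]
  rw [lintegral_const_mul _ hm'.lintegral_prod_right', mul_assoc]
  congr 1
  rw [← lintegral_prod _ hm'.aemeasurable, ← Measure.volume_eq_prod,
    ← lintegral_comp_polarCoord_symm, polarCoord_target]
  -- The Jacobians `r` and `r sin θ` multiply to `r² sin θ`, and the integrand separates.
  have h4 : ∀ p ∈ Ioi (0 : ℝ) ×ˢ Ioo (-π) π,
      ENNReal.ofReal p.1 • indicator (Ioi (0 : ℝ))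
        (fun r => ENNReal.ofReal r * h (polarCoord.symm p).1 (r ^ 2)) (polarCoord.symm p).2 =
      (ENNReal.ofReal (p.1 ^ 2) * F (p.1 ^ 2)) *
        indicator (Ioo 0 π) (fun θ => ENNReal.ofReal (sin θ) * G θ) p.2 := by
    rintro ⟨r, θ⟩ ⟨hr, hθ⟩
    simp only [mem_Ioi, mem_Ioo] at hr hθ
    simp only [polarCoord_symm_apply, smul_eq_mul]
    by_cases h0 : 0 < θ
    · have hs : 0 < sin θ := sin_pos_of_pos_of_lt_pi h0 hθ.2
      rw [indicator_of_mem (mem_Ioi.2 (mul_pos hr hs)), indicator_of_mem (mem_Ioo.2 ⟨h0, hθ.2⟩)]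
      have : (r * cos θ) ^ 2 + (r * sin θ) ^ 2 = r ^ 2 := by
        linear_combination r ^ 2 * Real.sin_sq_add_cos_sq θ
      simp only [h, this, Real.sqrt_sq hr.le, mul_div_cancel_left₀ _ hr.ne',
        arccos_cos h0.le hθ.2.le, ENNReal.ofReal_mul hr.le, ENNReal.ofReal_pow hr.le]
      ring
    · have hs : sin θ ≤ 0 := sin_nonpos_of_nonpos_of_neg_pi_le (not_lt.1 h0) hθ.1.le
      rw [indicator_of_notMem, indicator_of_notMem]
      · simp
      · simp [h0]
      · simpa using mul_nonpos_of_nonneg_of_nonpos hr.le hs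
  rw [setLIntegral_congr_fun (measurableSet_Ioi.prod measurableSet_Ioo) h4,
    Measure.volume_eq_prod, ← Measure.prod_restrict,
    lintegral_prod_mul (f := fun r : ℝ => ENNReal.ofReal (r ^ 2) * F (r ^ 2))
      (g := indicator (Ioo 0 π) fun θ => ENNReal.ofReal (sin θ) * G θ) (by fun_prop)
      (Measurable.aemeasurable
      ((by fun_prop : Measurable fun θ => ENNReal.ofReal (sin θ) * G θ).indicator
        measurableSet_Ioo))]
  congr 1
  rw [lintegral_indicator measurableSet_Ioo, Measure.restrict_restrict measurableSet_Ioo,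
    inter_eq_left.2 (Ioo_subset_Ioo_left (by linarith [pi_pos]))]

end PolarIntegration

/-! ### Uniform direction of a standard Gaussian vector -/

theorem exists_linearIsometryEquiv_map_eq {V : Type*} [NormedAddCommGroup V]
    [InnerProductSpace ℝ V] {e e' : V} (h : ‖e‖ = ‖e'‖) : ∃ U : V ≃ₗᵢ[ℝ] V, U e = e' :=
  ⟨_, Submodule.reflection_sub h⟩

theorem measurePreserving_stdGaussian (U : E3 ≃ₗᵢ[ℝ] E3) :
    MeasurePreserving U (stdGaussian E3) (stdGaussian E3) :=
  ⟨U.continuous.measurable, stdGaussian_map U⟩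

theorem integral_sin_Ioo : ∫⁻ θ in Ioo 0 π, ENNReal.ofReal (sin θ) = 2 := by
  rw [← ofReal_integral_eq_lintegral_ofReal, ← integral_Ioc_eq_integral_Ioo,
    ← intervalIntegral.integral_of_le pi_pos.le, integral_sin]
  · norm_num
  · exact (Real.continuous_sin.integrableOn_Icc).mono_set Ioo_subset_Icc_self
  · filter_upwards [ae_restrict_mem measurableSet_Ioo] with θ hθ
    exact (sin_pos_of_pos_of_lt_pi hθ.1 hθ.2).le

theorem integral_sin_mul_sq : ∫ θ in (0 : ℝ)..π, sin θ * θ ^ 2 = π ^ 2 - 4 := by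
  have h : ∀ θ ∈ uIcc 0 π, HasDerivAt (fun θ : ℝ => -θ ^ 2 * cos θ + 2 * θ * sin θ + 2 * cos θ)
      (sin θ * θ ^ 2) θ := by
    intro θ _
    have h1 := ((((hasDerivAt_id θ).pow 2).neg).mul (Real.hasDerivAt_cos θ))
    have h2 := (((hasDerivAt_id θ).const_mul 2).mul (Real.hasDerivAt_sin θ))
    have h3 := (Real.hasDerivAt_cos θ).const_mul 2
    convert! (h1.add h2).add h3 using 1
    simp
    ring
  rw [intervalIntegral.integral_eq_sub_of_hasDerivAt h
    (by apply Continuous.intervalIntegrable; fun_prop)]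
  simp
  ring

/-- The direction of a standard Gaussian vector in `ℝ³` is uniform on the sphere: its angle to a
fixed axis has density `sin θ / 2`. -/
theorem lintegral_angle_stdGaussian {e : E3} (he : ‖e‖ = 1) {G : ℝ → ℝ≥0∞} (hG : Measurable G) :
    ∫⁻ z, G (angle e z) ∂stdGaussian E3 =
      2⁻¹ * ∫⁻ θ in Ioo 0 π, ENNReal.ofReal (sin θ) * G θ := by
  obtain ⟨c, hc, hd⟩ := exists_stdGaussian_eq_withDensity (V := E3)
  let F : ℝ → ℝ≥0∞ := fun q => ENNReal.ofReal (c * rexp (-(1 / 2) * q))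
  have hF : Measurable F := by simp only [F]; fun_prop
  set e₀ : E3 := EuclideanSpace.single 0 1 with he₀
  set C := ENNReal.ofReal (2 * π) * ∫⁻ r in Ioi (0 : ℝ), ENNReal.ofReal (r ^ 2) * F (r ^ 2)
  have key : ∀ G : ℝ → ℝ≥0∞, Measurable G → ∫⁻ z, G (angle e₀ z) ∂stdGaussian E3 =
      C * ∫⁻ θ in Ioo 0 π, ENNReal.ofReal (sin θ) * G θ := by
    intro G hG
    rw [← lintegral_norm_mul_angle hF hG, hd]
    exact lintegral_withDensity_eq_lintegral_mul _ (by fun_prop) (hG.comp (measurable_angle e₀))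
  -- Total mass one, tested with `G = 1`, fixes the constant without computing the radial integral.
  have hC : C = 2⁻¹ := by
    have h := key (fun _ => 1) measurable_const
    simp only [lintegral_const, measure_univ, mul_one, integral_sin_Ioo] at h
    exact ENNReal.eq_inv_of_mul_eq_one_left h.symm
  obtain ⟨U, hU⟩ := exists_linearIsometryEquiv_map_eq (e := e) (e' := e₀) (by simp [he, he₀])
  rw [← hC, ← key G hG]
  refine Eq.trans (lintegral_congr fun z => ?_) ((measurePreserving_stdGaussian U).lintegral_comp
    (hG.comp (measurable_angle e₀)))
  rw [← hU]
  exact congrArg G (U.toLinearIsometry.angle_map e z).symm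

theorem integral_sq_angle_stdGaussian {e : E3} (he : ‖e‖ = 1) :
    ∫ z, angle e z ^ 2 ∂stdGaussian E3 = (π ^ 2 - 4) / 2 := by
  rw [integral_eq_lintegral_of_nonneg_ae (ae_of_all _ fun _ => sq_nonneg _)
    ((measurable_angle e).pow_const 2).aestronglyMeasurable,
    lintegral_angle_stdGaussian he (G := fun θ => ENNReal.ofReal (θ ^ 2)) (by fun_prop)]
  have h : ∫⁻ θ in Ioo 0 π, ENNReal.ofReal (sin θ) * ENNReal.ofReal (θ ^ 2) =
      ENNReal.ofReal (π ^ 2 - 4) := by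
    rw [← integral_sin_mul_sq, intervalIntegral.integral_of_le pi_pos.le,
      integral_Ioc_eq_integral_Ioo, ofReal_integral_eq_lintegral_ofReal]
    · refine setLIntegral_congr_fun measurableSet_Ioo fun θ hθ => ?_
      exact (ENNReal.ofReal_mul (sin_pos_of_pos_of_lt_pi hθ.1 hθ.2).le).symm
    · exact (Continuous.integrableOn_Icc (by fun_prop)).mono_set Ioo_subset_Icc_self
    · filter_upwards [ae_restrict_mem measurableSet_Ioo] with θ hθ
      exact mul_nonneg (sin_pos_of_pos_of_lt_pi hθ.1 hθ.2).le (sq_nonneg θ)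
  rw [h, ENNReal.toReal_mul, ENNReal.toReal_ofReal (by nlinarith [pi_gt_three])]
  simp
  ring

/-- Off this null line `e + sz` is neither zero nor, for `s ≥ 0`, opposite to `e`, so the arbitrary
values of `pr` and `sphLog` play no role. -/
theorem ae_notMem_span_singleton (e : E3) :
    ∀ᵐ z ∂stdGaussian E3, z ∉ Submodule.span ℝ {e} := by
  refine ae_stdGaussian_notMem_submodule _ fun h => ?_
  have h1 := finrank_span_le_card (R := ℝ) ({e} : Set E3)
  rw [h, finrank_top] at h1
  simp at h1

/-! ### Radial projection and the law of the projected normal -/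

section Projection

theorem coe_pr {x : E3} (hx : x ≠ 0) : (pr x : E3) = ‖x‖⁻¹ • x := by
  simp [pr, hx]

@[fun_prop]
theorem measurable_pr : Measurable pr := by
  have h : Measurable fun x : E3 => (pr x : E3) := by
    have : (fun x : E3 => (pr x : E3)) =
        fun x => if x = 0 then EuclideanSpace.single 0 1 else ‖x‖⁻¹ • x := by
      ext1 x
      unfold pr
      split_ifs <;> rfl
    rw [this]
    exact Measurable.ite (measurableSet_singleton 0) measurable_const (by fun_prop)
  exact h.subtype_mk (h := fun x => (pr x).2)

theorem pr_smul {r : ℝ} (hr : 0 < r) (x : E3) : pr (r • x) = pr x := by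
  rcases eq_or_ne x 0 with rfl | hx
  · simp
  · apply Subtype.ext
    rw [coe_pr hx, coe_pr (smul_ne_zero hr.ne' hx), norm_smul, Real.norm_of_nonneg hr.le, smul_smul]
    congr 1
    field_simp

theorem norm_coe_sphere (q : S2) : ‖(q : E3)‖ = 1 := by simp

theorem coe_sphere_ne_zero (q : S2) : (q : E3) ≠ 0 := ne_zero_of_mem_unit_sphere q

theorem sphDist_pr (q : S2) {x : E3} (hx : x ≠ 0) : sphDist q (pr x) = angle (q : E3) x := by
  rw [sphDist, angle, coe_pr hx, inner_smul_right, norm_coe_sphere]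
  congr 1
  field_simp

@[fun_prop]
theorem measurable_sphDist (q : S2) : Measurable (sphDist q) := by
  unfold sphDist
  fun_prop

end Projection

/-- The law of `pr (e + s Z)` for a standard Gaussian vector `Z`. -/
noncomputable def projectedLaw (e : S2) (s : ℝ) : Measure S2 :=
  (stdGaussian E3).map fun z => pr ((e : E3) + s • z)

theorem measurable_pr_self_add_smul (e : S2) (s : ℝ) :
    Measurable fun z : E3 => pr ((e : E3) + s • z) := by
  fun_prop

instance (e : S2) (s : ℝ) : IsProbabilityMeasure (projectedLaw e s) :=
  Measure.isProbabilityMeasure_map (measurable_pr_self_add_smul e s).aemeasurable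

open scoped MatrixOrder in
theorem multivariateGaussian_smul_one (μ : E3) {σ : ℝ} (hσ : 0 ≤ σ) :
    multivariateGaussian μ (σ ^ 2 • (1 : Matrix (Fin 3) (Fin 3) ℝ)) =
      (stdGaussian E3).map fun z => μ + σ • z := by
  have h : CFC.sqrt (σ ^ 2 • (1 : Matrix (Fin 3) (Fin 3) ℝ)) =
      σ • (1 : Matrix (Fin 3) (Fin 3) ℝ) := by
    refine CFC.sqrt_unique ?_ ?_
    · rw [smul_mul_smul_comm, mul_one, pow_two]
    · exact (Matrix.PosSemidef.one.smul hσ).nonneg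
  rw [multivariateGaussian, h]
  simp

theorem map_pr_of_hasLaw {Ω : Type*} [MeasurableSpace Ω] {P : Measure Ω} {X : Ω → E3} {μ : E3}
    {σ : ℝ} (hμ : μ ≠ 0) (hσ : 0 ≤ σ)
    (hX : HasLaw X (multivariateGaussian μ (σ ^ 2 • (1 : Matrix (Fin 3) (Fin 3) ℝ))) P) :
    P.map (fun ω => pr (X ω)) = projectedLaw (pr μ) (σ / ‖μ‖) := by
  have hμ' : 0 < ‖μ‖ := norm_pos_iff.2 hμ
  have h1 : P.map (fun ω => pr (X ω)) = (P.map X).map pr :=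
    (AEMeasurable.map_map_of_aemeasurable measurable_pr.aemeasurable hX.aemeasurable).symm
  rw [h1, hX.map_eq, multivariateGaussian_smul_one μ hσ,
    Measure.map_map measurable_pr (by fun_prop), projectedLaw]
  congr 1
  ext1 z
  rw [Function.comp_apply, ← pr_smul hμ' ((pr μ : E3) + (σ / ‖μ‖) • z), coe_pr hμ, smul_add,
    smul_inv_smul₀ hμ'.ne', smul_smul, mul_div_cancel₀ _ hμ'.ne']

theorem integral_sphDist_sq (e q : S2) (s : ℝ) :
    ∫ y, sphDist q y ^ 2 ∂projectedLaw e s =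
      ∫ z, angle (q : E3) ((e : E3) + s • z) ^ 2 ∂stdGaussian E3 := by
  rw [projectedLaw, integral_map (measurable_pr_self_add_smul e s).aemeasurable
    ((measurable_sphDist q).pow_const 2).aestronglyMeasurable]
  refine integral_congr_ae ?_
  filter_upwards [ae_notMem_span_singleton (e : E3)] with z hz
  rw [sphDist_pr q (self_add_smul_ne_zero (coe_sphere_ne_zero e) hz s)]

theorem measurable_angle_self_add_smul (q e : E3) (s : ℝ) :
    Measurable fun z : E3 => angle q (e + s • z) :=
  (measurable_angle q).comp (by fun_prop)

theorem sq_angle_le (x y : E3) : ‖angle x y ^ 2‖ ≤ π ^ 2 := by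
  rw [norm_pow, Real.norm_of_nonneg (angle_nonneg _ _)]
  exact pow_le_pow_left₀ (angle_nonneg _ _) (angle_le_pi _ _) 2

theorem integrable_sq_angle (q e : E3) (s : ℝ) :
    Integrable (fun z : E3 => angle q (e + s • z) ^ 2) (stdGaussian E3) :=
  Integrable.of_bound ((measurable_angle_self_add_smul q e s).pow_const 2).aestronglyMeasurable
    (π ^ 2) (ae_of_all _ fun _ => sq_angle_le _ _)

/-! ### Uniqueness of the intrinsic mean -/

section UniqueMean

theorem angle_le_angle_of_inner_le {e q x : E3} (he : ‖e‖ = 1) (hq : ‖q‖ = 1)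
    (h : inner ℝ q x ≤ inner ℝ e x) : angle e x ≤ angle q x := by
  refine Real.antitone_arccos ?_
  rw [he, hq]
  gcongr

theorem angle_lt_angle_of_inner_lt {e q x : E3} (he : ‖e‖ = 1) (hq : ‖q‖ = 1)
    (h : inner ℝ q x < inner ℝ e x) : angle e x < angle q x := by
  have hx : x ≠ 0 := by rintro rfl; simp at h
  have hx' : 0 < ‖x‖ := norm_pos_iff.2 hx
  refine Real.strictAntiOn_arccos ?_ ?_ ?_
  · exact abs_le.1 (abs_real_inner_div_norm_mul_norm_le_one q x)
  · exact abs_le.1 (abs_real_inner_div_norm_mul_norm_le_one e x)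
  · rw [he, hq]
    gcongr

theorem norm_sub_sq_sub_norm_sub_sq {e q x : E3} (he : ‖e‖ = 1) (hq : ‖q‖ = 1) :
    ‖x - q‖ ^ 2 - ‖x - e‖ ^ 2 = 2 * (inner ℝ e x - inner ℝ q x) := by
  rw [norm_sub_sq_real, norm_sub_sq_real, he, hq, real_inner_comm, real_inner_comm x e]
  ring

/-- The point `e` is strictly closer on average to `e + s Z` than any other point `q`: reflecting
in the bisecting plane of `e` and `q` exchanges the two angles, and the Gaussian density is larger
on the side of `e`. -/
theorem integral_sq_angle_lt {e q : E3} (he : ‖e‖ = 1) (hq : ‖q‖ = 1) (hne : q ≠ e) {s : ℝ}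
    (hs : 0 < s) :
    ∫ z, angle e (e + s • z) ^ 2 ∂stdGaussian E3 <
      ∫ z, angle q (e + s • z) ^ 2 ∂stdGaussian E3 := by
  obtain ⟨c, hc, hd⟩ := exists_stdGaussian_eq_withDensity (V := E3)
  set ρ : E3 → ℝ := fun z => c * rexp (-(1 / 2) * ‖z‖ ^ 2) with hρ
  have hρpos : ∀ z, 0 < ρ z := fun z => by simp only [hρ]; positivity
  have hρm : Measurable ρ := by simp only [hρ]; fun_prop
  set D : E3 → ℝ := fun z => angle q (e + s • z) ^ 2 - angle e (e + s • z) ^ 2 with hD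
  have hDm : Measurable D :=
    ((measurable_angle_self_add_smul q e s).pow_const 2).sub
      ((measurable_angle_self_add_smul e e s).pow_const 2)
  have hDi : Integrable D (stdGaussian E3) :=
    (integrable_sq_angle q e s).sub (integrable_sq_angle e e s)
  rw [← sub_pos, ← integral_sub (integrable_sq_angle q e s) (integrable_sq_angle e e s)]
  change 0 < ∫ z, D z ∂stdGaussian E3
  have hinteg : Integrable fun z => ρ z * D z := by
    rw [hd, integrable_withDensity_iff (by fun_prop) (by simp)] at hDi
    refine hDi.congr (ae_of_all _ fun z => ?_)
    change D z * (ENNReal.ofReal (ρ z)).toReal = _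
    rw [ENNReal.toReal_ofReal (hρpos z).le, mul_comm]
  have hval : ∫ z, D z ∂stdGaussian E3 = ∫ z, ρ z * D z := by
    rw [hd, integral_withDensity_eq_integral_toReal_smul (by fun_prop) (by simp)]
    refine integral_congr_ae (ae_of_all _ fun z => ?_)
    change (ENNReal.ofReal (ρ z)).toReal • D z = _
    rw [ENNReal.toReal_ofReal (hρpos z).le, smul_eq_mul]
  set R : E3 ≃ₗᵢ[ℝ] E3 := (Submodule.span ℝ {e - q})ᗮ.reflection
  have hRe : R e = q := Submodule.reflection_sub (by rw [he, hq])
  have hRq : R q = e := by rw [← hRe]; exact Submodule.reflection_reflection _ e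
  -- `T` is the reflection `R`, which swaps `e` and `q`, read in the coordinate `z` of `x = e + sz`.
  set T : E3 → E3 := fun z => R z + s⁻¹ • (q - e) with hTdef
  have hT : MeasurePreserving T volume volume :=
    (measurePreserving_add_right volume (s⁻¹ • (q - e))).comp R.measurePreserving
  have hTx : ∀ z, e + s • T z = R (e + s • z) := by
    intro z
    simp only [hTdef, smul_add, smul_inv_smul₀ hs.ne', map_add, map_smul, hRe]
    abel
  have hDT : ∀ z, D (T z) = -D z := by
    intro z
    have h1 : angle q (R (e + s • z)) = angle e (e + s • z) := by
      rw [← hRe]; exact R.toLinearIsometry.angle_map _ _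
    have h2 : angle e (R (e + s • z)) = angle q (e + s • z) := by
      exact (congrArg (angle · _) hRq).symm.trans (R.toLinearIsometry.angle_map _ _)
    simp only [hD, hTx, h1, h2]
    ring
  -- Since `s‖z‖ = ‖x - e‖` and `s‖T z‖ = ‖x - q‖`, the density is larger at `z` than at `T z`
  -- exactly when `x` lies on the side of `e`.
  have hnorm : ∀ z, ‖T z‖ ^ 2 - ‖z‖ ^ 2 =
      2 * (inner ℝ e (e + s • z) - inner ℝ q (e + s • z)) / s ^ 2 := by
    intro z
    rw [← norm_sub_sq_sub_norm_sub_sq he hq]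
    have h1 : s * ‖T z‖ = ‖e + s • z - q‖ := by
      rw [← R.norm_map (e + s • z - q), map_sub, ← hTx, hRq, add_sub_cancel_left, norm_smul,
        Real.norm_of_nonneg hs.le]
    have h2 : s * ‖z‖ = ‖e + s • z - e‖ := by
      rw [add_sub_cancel_left, norm_smul, Real.norm_of_nonneg hs.le]
    rw [← h1, ← h2]
    field_simp
  have hcomp : ∫ z, ρ z * D z = ∫ z, -(ρ (T z) * D z) := by
    conv_lhs => rw [← hT.map_eq]
    rw [integral_map hT.measurable.aemeasurable
      (by fun_prop : Measurable fun z => ρ z * D z).aestronglyMeasurable]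
    simp only [hDT, mul_neg]
  have hinteg' : Integrable fun z => -(ρ (T z) * D z) := by
    have := (hT.integrable_comp hinteg.aestronglyMeasurable).2 hinteg
    refine this.congr (ae_of_all _ fun z => ?_)
    simp [hDT]
  -- Averaging the integral with its image under `T` gives an integrand whose two factors have the
  -- same sign.
  have hsum : 2 * ∫ z, ρ z * D z = ∫ z, (ρ z - ρ (T z)) * D z := by
    rw [two_mul]
    conv_lhs => rhs; rw [hcomp]
    rw [← integral_add hinteg hinteg']
    exact integral_congr_ae (ae_of_all _ fun z => by ring)
  have hρlt : ∀ z w : E3, ‖z‖ ^ 2 < ‖w‖ ^ 2 → ρ w < ρ z := by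
    intro z w h
    simp only [hρ]
    gcongr ?_ * rexp ?_
    linarith
  have hρle : ∀ z w : E3, ‖z‖ ^ 2 ≤ ‖w‖ ^ 2 → ρ w ≤ ρ z := by
    intro z w h
    simp only [hρ]
    gcongr ?_ * rexp ?_
    linarith
  have hnonneg : ∀ z, 0 ≤ (ρ z - ρ (T z)) * D z := by
    intro z
    have hz := hnorm z
    rcases le_total (inner ℝ q (e + s • z)) (inner ℝ e (e + s • z)) with h | h
    · have h1 : 0 ≤ ‖T z‖ ^ 2 - ‖z‖ ^ 2 := by
        rw [hz]
        exact div_nonneg (by linarith) (sq_nonneg s)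
      refine mul_nonneg (sub_nonneg.2 (hρle _ _ (by linarith))) (sub_nonneg.2 ?_)
      exact pow_le_pow_left₀ (angle_nonneg _ _) (angle_le_angle_of_inner_le he hq h) 2
    · have h1 : ‖T z‖ ^ 2 - ‖z‖ ^ 2 ≤ 0 := by
        rw [hz]
        exact div_nonpos_of_nonpos_of_nonneg (by linarith) (sq_nonneg s)
      refine mul_nonneg_of_nonpos_of_nonpos (sub_nonpos.2 (hρle _ _ (by linarith)))
        (sub_nonpos.2 ?_)
      exact pow_le_pow_left₀ (angle_nonneg _ _) (angle_le_angle_of_inner_le hq he h) 2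
  have hpos : 0 < ∫ z, (ρ z - ρ (T z)) * D z := by
    rw [integral_pos_iff_support_of_nonneg hnonneg
      ((hinteg.add hinteg').congr (ae_of_all _ fun z => by simp only [Pi.add_apply]; ring))]
    -- The integrand is positive on the open side of `e`, which contains `z = 0`.
    set O : Set E3 := {z | inner ℝ q (e + s • z) < inner ℝ e (e + s • z)}
    have hO : IsOpen O := isOpen_lt (by fun_prop) (by fun_prop)
    have h0 : (0 : E3) ∈ O := by
      have : inner ℝ q e < 1 :=
        (inner_lt_one_iff_real_of_norm_eq_one hq he).2 hne
      simpa [O, he] using this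
    refine (hO.measure_pos volume ⟨0, h0⟩).trans_le (measure_mono fun z hz => ?_)
    have hz' : inner ℝ q (e + s • z) < inner ℝ e (e + s • z) := hz
    have h1 : 0 < ‖T z‖ ^ 2 - ‖z‖ ^ 2 := by
      rw [hnorm z]
      exact div_pos (by linarith) (by positivity)
    refine (mul_pos (sub_pos.2 (hρlt _ _ (by linarith))) (sub_pos.2 ?_)).ne'
    exact pow_lt_pow_left₀ (angle_lt_angle_of_inner_lt he hq hz') (angle_nonneg _ _) two_ne_zero
  linarith

theorem integral_sphDist_sq_lt (e q : S2) (hne : q ≠ e) {s : ℝ} (hs : 0 ≤ s) :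
    ∫ y, sphDist e y ^ 2 ∂projectedLaw e s < ∫ y, sphDist q y ^ 2 ∂projectedLaw e s := by
  have hne' : (q : E3) ≠ e := fun h => hne (Subtype.ext h)
  rw [integral_sphDist_sq, integral_sphDist_sq]
  rcases hs.eq_or_lt with rfl | hs
  · have h : angle (q : E3) e ≠ 0 := fun h =>
      hne' (eq_of_angle_eq_zero_of_norm_eq h (by simp))
    simpa [angle_self (coe_sphere_ne_zero e)] using sq_pos_of_ne_zero h
  · exact integral_sq_angle_lt (norm_coe_sphere e) (norm_coe_sphere q) hne' hs

theorem isIntrinsicMean_projectedLaw_iff {e m : S2} {s : ℝ} (hs : 0 ≤ s) :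
    IsIntrinsicMean (projectedLaw e s) m ↔ m = e := by
  constructor
  · intro h
    by_contra hne
    exact (h e).not_gt (integral_sphDist_sq_lt e m hne hs)
  · rintro rfl q
    rcases eq_or_ne q m with rfl | hq
    · rfl
    · exact (integral_sphDist_sq_lt m q hq hs).le

end UniqueMean

/-! ### The Riemannian logarithm -/

section Log

theorem inner_tangent_eq_zero {e : S2} (t : Tangent e) : inner ℝ (e : E3) (t : E3) = 0 :=
  Submodule.mem_orthogonal_singleton_iff_inner_right.1 t.2

theorem norm_sq_projection_tangent (e y : S2) :
    ‖(Tangent e).orthogonalProjectionOnto (y : E3)‖ ^ 2 =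
      1 - inner ℝ (e : E3) (y : E3) ^ 2 := by
  have h := Submodule.norm_sq_eq_add_norm_sq_projection (y : E3) (Submodule.span ℝ {(e : E3)})
  have h1 : ‖(Submodule.span ℝ {(e : E3)}).orthogonalProjectionOnto (y : E3)‖ ^ 2 =
      inner ℝ (e : E3) (y : E3) ^ 2 := by
    rw [Submodule.coe_norm, Submodule.coe_orthogonalProjectionOnto_apply,
      Submodule.starProjection_unit_singleton ℝ (norm_coe_sphere e), norm_smul, norm_coe_sphere,
      mul_one, Real.norm_eq_abs, sq_abs]
  rw [h1, norm_coe_sphere] at h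
  linarith

theorem norm_projection_tangent (e y : S2) :
    ‖(Tangent e).orthogonalProjectionOnto (y : E3)‖ = √(1 - inner ℝ (e : E3) (y : E3) ^ 2) := by
  rw [← norm_sq_projection_tangent, Real.sqrt_sq (norm_nonneg _)]

theorem inner_sphLog (e y : S2) (t : Tangent e) :
    inner ℝ (sphLog e y) t =
      sphDist e y / √(1 - inner ℝ (e : E3) (y : E3) ^ 2) * inner ℝ (y : E3) (t : E3) := by
  rw [sphLog, inner_smul_left, norm_projection_tangent,
    Submodule.inner_orthogonalProjectionOnto_eq_of_mem_right]
  simp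

theorem sphDist_nonneg (p q : S2) : 0 ≤ sphDist p q := Real.arccos_nonneg _

theorem sphDist_le_pi (p q : S2) : sphDist p q ≤ π := Real.arccos_le_pi _

/-- The hypothesis excludes the cut point, where `sphLog` takes the value `0`. At `y = e` the
quotient `0 / 0 = 0` gives the right length. -/
theorem norm_sphLog {e y : S2} (h : sphDist e y ≠ π) : ‖sphLog e y‖ = sphDist e y := by
  rw [sphLog, norm_smul, norm_div, norm_norm, Real.norm_of_nonneg (sphDist_nonneg e y)]
  rcases eq_or_ne ‖(Tangent e).orthogonalProjectionOnto (y : E3)‖ 0 with h0 | h0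
  · have h1 := norm_sq_projection_tangent e y
    rw [h0, zero_pow two_ne_zero, eq_comm, sub_eq_zero, eq_comm, sq_eq_one_iff] at h1
    rcases h1 with h1 | h1
    · simp [sphDist, h1]
    · exact absurd (by simp [sphDist, h1]) h
  · rw [div_mul_cancel₀ _ h0]

theorem norm_sphLog_le (e y : S2) : ‖sphLog e y‖ ≤ π := by
  rw [sphLog, norm_smul, norm_div, norm_norm, Real.norm_of_nonneg (sphDist_nonneg e y)]
  rcases eq_or_ne ‖(Tangent e).orthogonalProjectionOnto (y : E3)‖ 0 with h0 | h0
  · simpa [h0] using pi_pos.le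
  · rw [div_mul_cancel₀ _ h0]
    exact sphDist_le_pi e y

@[fun_prop]
theorem measurable_sphLog (e : S2) : Measurable (sphLog e) := by
  unfold sphLog
  fun_prop

end Log

/-! ### Isotropy of the covariance -/

theorem integrable_rankOne_sphLog (e : S2) (ν : Measure S2) [IsFiniteMeasure ν] :
    Integrable (fun y => InnerProductSpace.rankOne ℝ (sphLog e y) (sphLog e y)) ν := by
  refine Integrable.of_bound (C := π ^ 2) ?_ (ae_of_all _ fun y => ?_)
  · exact Continuous.comp_aestronglyMeasurable
      (g := fun x : Tangent e => InnerProductSpace.rankOne ℝ x x)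
      ((InnerProductSpace.rankOne ℝ).continuous.clm_apply continuous_id)
      (measurable_sphLog e).aestronglyMeasurable
  · rw [InnerProductSpace.norm_rankOne, ← pow_two]
    exact pow_le_pow_left₀ (norm_nonneg _) (norm_sphLog_le e y) 2

theorem inner_intrinsicCov (e : S2) (ν : Measure S2) [IsFiniteMeasure ν] (t t' : Tangent e) :
    inner ℝ (intrinsicCov ν e t) t' =
      ∫ y, inner ℝ (sphLog e y) t * inner ℝ (sphLog e y) t' ∂ν := by
  have h := integrable_rankOne_sphLog e ν
  rw [intrinsicCov, ContinuousLinearMap.integral_apply h, real_inner_comm,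
    ← integral_inner (h.apply_continuousLinearMap t)]
  refine integral_congr_ae (ae_of_all _ fun y => ?_)
  simp only [InnerProductSpace.rankOne_apply, inner_smul_right, real_inner_comm t' (sphLog e y)]

theorem coe_pr_map (U : E3 ≃ₗᵢ[ℝ] E3) {x : E3} (hx : x ≠ 0) : (pr (U x) : E3) = U (pr x : E3) := by
  rw [coe_pr hx, coe_pr (by simpa using hx), U.norm_map, map_smul]

/-- The reflection swapping `t` and `t'` fixes `e`, because `t - t'` is tangent at `e`; it preserves
the Gaussian and so the projected law. -/
theorem integral_inner_sphLog_sq_eq_of_norm_eq (e : S2) (s : ℝ) {t t' : Tangent e}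
    (h : ‖t‖ = ‖t'‖) :
    ∫ y, inner ℝ (sphLog e y) t ^ 2 ∂projectedLaw e s =
      ∫ y, inner ℝ (sphLog e y) t' ^ 2 ∂projectedLaw e s := by
  set U : E3 ≃ₗᵢ[ℝ] E3 := (Submodule.span ℝ {(t : E3) - t'})ᗮ.reflection
  have hUt : U t = t' := Submodule.reflection_sub (by simpa using h)
  have hUe : U e = e := by
    refine Submodule.reflection_mem_subspace_eq_self
      (Submodule.mem_orthogonal_singleton_iff_inner_left.2 ?_)
    rw [inner_sub_right, inner_tangent_eq_zero, inner_tangent_eq_zero, sub_zero]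
  have hm : ∀ t : Tangent e, Measurable fun y => inner ℝ (sphLog e y) t ^ 2 := fun t => by fun_prop
  have hp := measurable_pr_self_add_smul e s
  simp only [projectedLaw]
  rw [integral_map hp.aemeasurable (hm t).aestronglyMeasurable,
    integral_map hp.aemeasurable (hm t').aestronglyMeasurable]
  conv_rhs => rw [← (measurePreserving_stdGaussian U).map_eq]
  rw [integral_map (measurePreserving_stdGaussian U).measurable.aemeasurable
    (by fun_prop : Measurable _).aestronglyMeasurable]
  refine integral_congr_ae ?_
  filter_upwards [ae_notMem_span_singleton (e : E3)] with z hz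
  have hx := self_add_smul_ne_zero (coe_sphere_ne_zero e) hz s
  have hUx : (e : E3) + s • U z = U (e + s • z) := by rw [map_add, map_smul, hUe]
  have hin : ∀ y : E3, inner ℝ (e : E3) (U y) = inner ℝ (e : E3) y := fun y => by
    conv_lhs => rw [← hUe]
    exact U.inner_map_map _ _
  rw [inner_sphLog, inner_sphLog, sphDist, sphDist, hUx, coe_pr_map U hx, hin, ← hUt,
    U.inner_map_map]

theorem finrank_tangent (e : S2) : Module.finrank ℝ (Tangent e) = 2 := by
  have : Fact (Module.finrank ℝ E3 = 2 + 1) := ⟨by simp⟩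
  exact Submodule.finrank_orthogonal_span_singleton (coe_sphere_ne_zero e)

theorem integral_norm_sphLog_sq (e : S2) {s : ℝ} (hs : 0 ≤ s) :
    ∫ y, ‖sphLog e y‖ ^ 2 ∂projectedLaw e s = ∫ y, sphDist e y ^ 2 ∂projectedLaw e s := by
  have hp := measurable_pr_self_add_smul e s
  simp only [projectedLaw]
  rw [integral_map hp.aemeasurable (by fun_prop : Measurable _).aestronglyMeasurable,
    integral_map hp.aemeasurable (by fun_prop : Measurable _).aestronglyMeasurable]
  refine integral_congr_ae ?_
  filter_upwards [ae_notMem_span_singleton (e : E3)] with z hz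
  rw [norm_sphLog]
  rw [sphDist_pr e (self_add_smul_ne_zero (coe_sphere_ne_zero e) hz s)]
  exact ((angle_self_add_smul_lt (norm_coe_sphere e) hz hs).trans_le (angle_le_pi _ _)).ne

/-- The quadratic form depends only on the norm, so it is `c‖t‖²`. A symmetric operator with zero
quadratic form vanishes, which identifies the covariance as `c • id`; summing over an orthonormal
basis of the tangent plane gives `2c`. -/
theorem intrinsicCov_projectedLaw (e : S2) {s : ℝ} (hs : 0 ≤ s) :
    intrinsicCov (projectedLaw e s) e =
      ((∫ y, sphDist e y ^ 2 ∂projectedLaw e s) / 2) •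
        ContinuousLinearMap.id ℝ (Tangent e) := by
  set ν := projectedLaw e s
  set A := intrinsicCov ν e
  let b : OrthonormalBasis (Fin 2) ℝ (Tangent e) :=
    (stdOrthonormalBasis ℝ (Tangent e)).reindex (finCongr (finrank_tangent e))
  have hA : ∀ t t' : Tangent e, inner ℝ (A t) t' =
      ∫ y, inner ℝ (sphLog e y) t * inner ℝ (sphLog e y) t' ∂ν := inner_intrinsicCov e ν
  have hdiag : ∀ t : Tangent e, inner ℝ (A t) t = ∫ y, inner ℝ (sphLog e y) t ^ 2 ∂ν := fun t => by
    rw [hA]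
    simp only [pow_two]
  set c := inner ℝ (A (b 0)) (b 0) with hc
  have hquad : ∀ t : Tangent e, inner ℝ (A t) t = c * ‖t‖ ^ 2 := by
    intro t
    have hn : ‖t‖ = ‖‖t‖ • b 0‖ := by simp [norm_smul]
    rw [hdiag, integral_inner_sphLog_sq_eq_of_norm_eq e s hn, ← hdiag, map_smul, inner_smul_left,
      inner_smul_right, ← hc]
    simp only [conj_trivial]
    ring
  have hsymm : (A - c • ContinuousLinearMap.id ℝ (Tangent e)).toLinearMap.IsSymmetric := by
    intro t t'
    simp only [ContinuousLinearMap.coe_coe, sub_apply,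
      smul_apply, ContinuousLinearMap.id_apply, inner_sub_left,
      inner_sub_right, inner_smul_left, inner_smul_right, conj_trivial]
    rw [hA, real_inner_comm (A t') t, hA]
    simp only [mul_comm]
  have hzero := hsymm.inner_map_self_eq_zero.1 fun t => by
    simp only [ContinuousLinearMap.coe_coe, sub_apply,
      smul_apply, ContinuousLinearMap.id_apply, inner_sub_left,
      inner_smul_left, conj_trivial, hquad, real_inner_self_eq_norm_sq, sub_self]
  have hAc : A = c • ContinuousLinearMap.id ℝ (Tangent e) := by
    rw [← sub_eq_zero]
    exact ContinuousLinearMap.coe_injective hzero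
  have hinteg : ∀ t : Tangent e, Integrable (fun y => inner ℝ (sphLog e y) t ^ 2) ν := fun t => by
    refine Integrable.of_bound (C := (π * ‖t‖) ^ 2)
      (by fun_prop : Measurable _).aestronglyMeasurable (ae_of_all _ fun y => ?_)
    rw [norm_pow]
    refine pow_le_pow_left₀ (norm_nonneg _) ((norm_inner_le_norm _ _).trans ?_) 2
    exact mul_le_mul_of_nonneg_right (norm_sphLog_le e y) (norm_nonneg t)
  have htrace : c + c = ∫ y, sphDist e y ^ 2 ∂ν := by
    have h1 : inner ℝ (A (b 1)) (b 1) = c := by rw [hquad]; simp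
    calc c + c = inner ℝ (A (b 0)) (b 0) + inner ℝ (A (b 1)) (b 1) := by rw [h1]
      _ = ∫ y, ‖sphLog e y‖ ^ 2 ∂ν := by
        rw [hdiag, hdiag, ← integral_add (hinteg _) (hinteg _)]
        refine integral_congr_ae (ae_of_all _ fun y => ?_)
        simp only [← b.sum_sq_inner_left (sphLog e y), Fin.sum_univ_two]
      _ = _ := integral_norm_sphLog_sq e hs
  rw [hAc, ← htrace]
  congr 1
  ring

/-! ### The expected squared angle as a function of `s` -/

/-- The expected squared angle between the first coordinate vector `e₀` and `e₀ + s Z`, for a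
standard Gaussian vector `Z`. -/
noncomputable def spread (s : ℝ) : ℝ :=
  ∫ z, angle (EuclideanSpace.single 0 1 : E3) (EuclideanSpace.single 0 1 + s • z) ^ 2
    ∂stdGaussian E3

theorem spread_eq {e : E3} (he : ‖e‖ = 1) (s : ℝ) :
    spread s = ∫ z, angle e (e + s • z) ^ 2 ∂stdGaussian E3 := by
  obtain ⟨U, hU⟩ :=
    exists_linearIsometryEquiv_map_eq (e := e) (e' := EuclideanSpace.single 0 1) (by simp [he])
  rw [spread, ← hU]
  conv_lhs => rw [← (measurePreserving_stdGaussian U).map_eq]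
  rw [integral_map (measurePreserving_stdGaussian U).measurable.aemeasurable
    ((measurable_angle_self_add_smul _ _ s).pow_const 2).aestronglyMeasurable]
  refine integral_congr_ae (ae_of_all _ fun z => ?_)
  simp only [← map_smul, ← map_add]
  exact congrArg (· ^ 2) (U.toLinearIsometry.angle_map _ _)

theorem norm_single_zero_one : ‖(EuclideanSpace.single 0 1 : E3)‖ = 1 := by simp

theorem integral_lt_integral_of_ae_lt {α : Type*} [MeasurableSpace α] {ν : Measure α} [NeZero ν]
    {f g : α → ℝ} (hf : Integrable f ν) (hg : Integrable g ν) (h : ∀ᵐ x ∂ν, f x < g x) :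
    ∫ x, f x ∂ν < ∫ x, g x ∂ν := by
  rw [← sub_pos, ← integral_sub hg hf,
    integral_pos_iff_support_of_nonneg_ae (h.mono fun x hx => (sub_pos.2 hx).le) (hg.sub hf)]
  have h1 : Function.support (fun x => g x - f x) =ᵐ[ν] univ := by
    filter_upwards [h] with x hx
    exact eq_true (sub_pos.2 hx).ne'
  rw [measure_congr h1]
  exact NeZero.pos _

theorem spread_strictMonoOn : StrictMonoOn spread (Ici 0) := by
  intro s hs s' hs' h
  refine integral_lt_integral_of_ae_lt (integrable_sq_angle _ _ s) (integrable_sq_angle _ _ s') ?_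
  filter_upwards [ae_notMem_span_singleton (EuclideanSpace.single 0 1 : E3)] with z hz
  exact pow_lt_pow_left₀
    (angle_self_add_smul_strictMonoOn norm_single_zero_one hz hs hs' h) (angle_nonneg _ _)
    two_ne_zero

theorem spread_lt {s : ℝ} (hs : 0 ≤ s) : spread s < (π ^ 2 - 4) / 2 := by
  rw [← integral_sq_angle_stdGaussian norm_single_zero_one]
  refine integral_lt_integral_of_ae_lt (integrable_sq_angle _ _ s) ?_ ?_
  · simpa using integrable_sq_angle (EuclideanSpace.single 0 1 : E3) 0 1
  filter_upwards [ae_notMem_span_singleton (EuclideanSpace.single 0 1 : E3)] with z hz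
  exact pow_lt_pow_left₀ (angle_self_add_smul_lt norm_single_zero_one hz hs) (angle_nonneg _ _)
    two_ne_zero

theorem spread_zero : spread 0 = 0 := by
  simp [spread]

theorem spread_nonneg (s : ℝ) : 0 ≤ spread s :=
  integral_nonneg fun _ => sq_nonneg _

theorem continuous_spread : Continuous spread := by
  refine continuous_of_dominated (bound := fun _ => π ^ 2)
    (fun s => (integrable_sq_angle _ _ s).aestronglyMeasurable)
    (fun s => ae_of_all _ fun z => sq_angle_le _ _) (integrable_const _) ?_
  filter_upwards [ae_notMem_span_singleton (EuclideanSpace.single 0 1 : E3)] with z hz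
  exact (continuous_angle_self_add_smul (by simp) hz).pow 2

theorem tendsto_spread : Filter.Tendsto spread Filter.atTop (nhds ((π ^ 2 - 4) / 2)) := by
  rw [← integral_sq_angle_stdGaussian norm_single_zero_one]
  refine tendsto_integral_filter_of_dominated_convergence (fun _ => π ^ 2)
    (Filter.Eventually.of_forall fun s => (integrable_sq_angle _ _ s).aestronglyMeasurable)
    (Filter.Eventually.of_forall fun s => ae_of_all _ fun z => sq_angle_le _ _)
    (integrable_const _) ?_
  filter_upwards [ae_notMem_span_singleton (EuclideanSpace.single 0 1 : E3)] with z hz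
  exact (tendsto_angle_self_add_smul (by simp) (by rintro rfl; simp at hz)).pow 2

/-- Half the trace of the intrinsic covariance, as a function of `σ² / ‖μ‖²`. -/
noncomputable def halfTrace (l : ℝ) : ℝ := spread (√l) / 2

theorem halfTrace_strictMonoOn : StrictMonoOn halfTrace (Ici 0) := by
  intro l hl l' hl' h
  have := spread_strictMonoOn (Real.sqrt_nonneg l) (Real.sqrt_nonneg l') (Real.sqrt_lt_sqrt hl h)
  exact div_lt_div_of_pos_right this two_pos

theorem halfTrace_mem_Ico (l : ℝ) : halfTrace l ∈ Ico 0 ((π ^ 2 - 4) / 4) := by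
  have h1 := spread_lt (Real.sqrt_nonneg l)
  have h2 := spread_nonneg (√l)
  rw [mem_Ico, halfTrace]
  constructor <;> linarith

/-- Surjectivity is the intermediate value theorem for `spread` between `0` and a point where it
exceeds `2v`, available because `2v` lies below the limit at infinity. -/
theorem halfTrace_bijOn : BijOn halfTrace (Ici 0) (Ico 0 ((π ^ 2 - 4) / 4)) := by
  refine ⟨fun l _ => halfTrace_mem_Ico l, halfTrace_strictMonoOn.injOn, fun v hv => ?_⟩
  have hv2 : 2 * v < (π ^ 2 - 4) / 2 := by linarith [hv.2]
  obtain ⟨b, hb, hb0⟩ := ((tendsto_spread.eventually_const_lt hv2).and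
    (Filter.eventually_ge_atTop 0)).exists
  obtain ⟨s, hs, hsv⟩ := intermediate_value_Icc hb0 continuous_spread.continuousOn
    (show 2 * v ∈ Icc (spread 0) (spread b) from
      ⟨by rw [spread_zero]; linarith [hv.1], hb.le⟩)
  refine ⟨s ^ 2, sq_nonneg s, ?_⟩
  rw [halfTrace, Real.sqrt_sq hs.1, hsv]
  ring

theorem halfTrace_eq (e : S2) {s : ℝ} (hs : 0 ≤ s) :
    halfTrace (s ^ 2) = (∫ y, sphDist e y ^ 2 ∂projectedLaw e s) / 2 := by
  rw [halfTrace, Real.sqrt_sq hs, integral_sphDist_sq, spread_eq (norm_coe_sphere e)]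

end ProjectedNormal

/-! ### The main theorem -/

theorem mainTheorem2 :
    ∃ f : ℝ → ℝ,
      StrictMonoOn f (Set.Ici 0) ∧
      Set.BijOn f (Set.Ici 0) (Set.Ico 0 ((Real.pi ^ 2 - 4) / 4)) ∧
      ∀ (Ω : Type*) [MeasurableSpace Ω] (P : MeasureTheory.Measure Ω)
        [MeasureTheory.IsProbabilityMeasure P]
        (X : Ω → ProjectedNormal.E3) (μ : ProjectedNormal.E3) (σ : ℝ),
        μ ≠ 0 → 0 ≤ σ →
        ProbabilityTheory.HasLaw X
          (ProbabilityTheory.multivariateGaussian μ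
            (σ ^ 2 • (1 : Matrix (Fin 3) (Fin 3) ℝ))) P →
        (∃! m, ProjectedNormal.IsIntrinsicMean (P.map fun ω => ProjectedNormal.pr (X ω)) m) ∧
        ∀ m, ProjectedNormal.IsIntrinsicMean (P.map fun ω => ProjectedNormal.pr (X ω)) m →
          ∃ v : ℝ, 0 ≤ v ∧ v < (Real.pi ^ 2 - 4) / 4 ∧
            ProjectedNormal.intrinsicCov (P.map fun ω => ProjectedNormal.pr (X ω)) m =
              v • ContinuousLinearMap.id ℝ (ProjectedNormal.Tangent m) ∧
            f (σ ^ 2 / ‖μ‖ ^ 2) =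
              LinearMap.trace ℝ (ProjectedNormal.Tangent m)
                (ProjectedNormal.intrinsicCov
                  (P.map fun ω => ProjectedNormal.pr (X ω)) m).toLinearMap / 2 ∧
            f (σ ^ 2 / ‖μ‖ ^ 2) = v := by
  refine ⟨ProjectedNormal.halfTrace, ProjectedNormal.halfTrace_strictMonoOn,
    ProjectedNormal.halfTrace_bijOn, ?_⟩
  intro Ω _ P _ X μ σ hμ hσ hX
  have hs : 0 ≤ σ / ‖μ‖ := by positivity
  rw [ProjectedNormal.map_pr_of_hasLaw hμ hσ hX]
  simp only [ProjectedNormal.isIntrinsicMean_projectedLaw_iff hs]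
  refine ⟨⟨_, rfl, fun m hm => hm⟩, ?_⟩
  rintro m rfl
  have hmem := ProjectedNormal.halfTrace_mem_Ico (σ ^ 2 / ‖μ‖ ^ 2)
  have hcov : ProjectedNormal.intrinsicCov
      (ProjectedNormal.projectedLaw (ProjectedNormal.pr μ) (σ / ‖μ‖)) (ProjectedNormal.pr μ) =
      ProjectedNormal.halfTrace (σ ^ 2 / ‖μ‖ ^ 2) •
        ContinuousLinearMap.id ℝ (ProjectedNormal.Tangent (ProjectedNormal.pr μ)) := by
    rw [ProjectedNormal.intrinsicCov_projectedLaw _ hs, ← ProjectedNormal.halfTrace_eq _ hs,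
      div_pow]
  refine ⟨_, hmem.1, hmem.2, hcov, ?_, rfl⟩
  rw [hcov, ContinuousLinearMap.toLinearMap_smul, map_smul, ContinuousLinearMap.coe_id,
    LinearMap.trace_id, ProjectedNormal.finrank_tangent]
  simp
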